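/- Let $\Omega\subset\mathbb R^N$ be a bounded open set (no regularity of $\partial\Omega$ and no connectedness is assumed), and let $f:\Omega\times\mathbb R^N\to\overline{\mathbb R}=[-\infty,+\infty]$ be a Borel function. For an open set $U\subseteq\Omega$, an open set $A\subseteq U$ and $u\in W^{1,\infty}(U)$ put $$F(u,A)=\operatorname*{ess\,sup}_{x\in A} f(x,Du(x))$$ (with $\operatorname{ess\,sup}_\emptyset=-\infty$). On $W^{1,\infty}(\Omega)$ consider the following topologies: $\tau_\infty$, induced by the inclusion $W^{1,\infty}(\Omega)\subseteq L^\infty(\Omega)$; $w^*$, induced by the embedding $u\mapsto(u,Du)$ into $L^\infty(\Omega)\times L^\infty(\Omega;\mathbb R^N)$ with its weak* topology as the dual of $L^1(\Omega)\times L^1(\Omega;\mathbb R^N)$; and $w^*_{seq}$, whose closed sets are the sequentially $w^*$-closed sets. Let $\tau$ be one of $\tau_\infty$, $w^*$, $w^*_{seq}$. Suppose that for every open ball $B_r\subseteq\Omega$: (a) $F(\cdot,B_r)$ is $\tau$-lower semicontinuous on $W^{1,\infty}(\Omega)$, i.e. $\{u\in W^{1,\infty}(\Omega): F(u,B_r)\le\lambda\}$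 is $\tau$-closed for every $\lambda\in\mathbb R$; (b) condition $(\mathbf H_{B_r})$ holds: there is a sequence $(u_n)$ in $W^{1,\infty}(B_r)$ such that $$\lim_{n\to\infty}F(u_n,B_r)=\inf_{w\in W^{1,\infty}(B_r)}F(w,B_r)\in\overline{\mathbb R}\qquad\text{and}\qquad \limsup_{\xi\to0}F(u_n+u_\xi,B_r)=F(u_n,B_r)\quad\text{for every } n,$$ where $u_\xi(x)=\xi\cdot x$, and where the value $\xi=0$ is admitted in the $\limsup$ (so that the equality says that $\xi\mapsto F(u_n+u_\xi,B_r)$ is upper semicontinuous at $0$). Then for every open set $A\subseteq\Omega$ the functional $F(\cdot,A)$ is level convex on $W^{1,\infty}(\Omega)$: $$F(\theta u_1+(1-\theta)u_2,A)\le \max\{F(u_1,A),F(u_2,A)\}\qquad\text{for all }\theta\in(0,1),\ u_1,u_2\in W^{1,\infty}(\Omega).$$ -/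

import Mathlib

open MeasureTheory Filter Topology
open scoped ENNReal ContDiff

noncomputable section

namespace Supremal

/-- Euclidean space `ℝ^N`. -/
abbrev Eucl (N : ℕ) : Type := EuclideanSpace ℝ (Fin N)

variable {N : ℕ}

/-- Lebesgue measure on `Ω`. -/
abbrev leb (Ω : Set (Eucl N)) : Measure (Eucl N) := (volume : Measure (Eucl N)).restrict Ω

/-- `g` is the weak (distributional) gradient of `u` on `Ω`: for every test function
`φ ∈ C_c^∞(Ω)` and every direction `v`, `∫_Ω u ∂_v φ = - ∫_Ω φ (g · v)`. -/
def HasWeakGradient (Ω : Set (Eucl N)) (u : Eucl N → ℝ) (g : Eucl N → Eucl N) : Prop :=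
  ∀ φ : Eucl N → ℝ, ContDiff ℝ ∞ φ → HasCompactSupport φ → tsupport φ ⊆ Ω →
    ∀ v : Eucl N,
      ∫ x in Ω, u x * fderiv ℝ φ x v = - ∫ x in Ω, φ x * inner ℝ (g x) v

/-- An essentially bounded function times a continuous compactly supported one is integrable. -/
theorem integrable_mul_of_memLp_top {Ω : Set (Eucl N)} {u φ : Eucl N → ℝ}
    (hu : MemLp u ∞ (leb Ω)) (hφ : Continuous φ) (hc : HasCompactSupport φ) :
    Integrable (fun x => u x * φ x) (leb Ω) := by
  have h := (hφ.integrable_of_hasCompactSupport (μ := leb Ω) hc).mul_of_top_right hu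
  exact h

/-- `fderiv φ · v` is continuous with compact support when `φ` is a test function. -/
theorem test_fderiv {φ : Eucl N → ℝ} (hφ : ContDiff ℝ ∞ φ) (hc : HasCompactSupport φ)
    (v : Eucl N) :
    Continuous (fun x => fderiv ℝ φ x v) ∧ HasCompactSupport (fun x => fderiv ℝ φ x v) :=
  ⟨(hφ.continuous_fderiv (by simp)).clm_apply continuous_const, hc.fderiv_apply ℝ v⟩

theorem memLp_inner_const {Ω : Set (Eucl N)} {g : Eucl N → Eucl N}
    (hg : MemLp g ∞ (leb Ω)) (v : Eucl N) :
    MemLp (fun x => inner ℝ (g x) v) ∞ (leb Ω) := by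
  have h := ((innerSL ℝ (E := Eucl N)) v).comp_memLp' hg
  refine h.ae_eq (Eventually.of_forall fun x => ?_)
  simp [real_inner_comm]

/-- The Sobolev space `W^{1,∞}(Ω)`, as the subspace of `L^∞(Ω) × L^∞(Ω; ℝ^N)` of the pairs
`(u, Du)` in which `Du` is the weak gradient of `u` (which `u` determines when `Ω` is open). -/
def W1inf (Ω : Set (Eucl N)) :
    Submodule ℝ (Lp ℝ ∞ (leb Ω) × Lp (Eucl N) ∞ (leb Ω)) where
  carrier := {p | HasWeakGradient Ω p.1 p.2}
  zero_mem' := by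
    intro φ _ _ _ v
    have h1 : ∫ x in Ω, ((0 : Lp ℝ ∞ (leb Ω)) : Eucl N → ℝ) x * fderiv ℝ φ x v = 0 := by
      rw [← integral_zero (Eucl N) ℝ (μ := leb Ω)]
      refine integral_congr_ae ?_
      filter_upwards [Lp.coeFn_zero ℝ ∞ (leb Ω)] with x hx
      rw [hx]
      simp
    have h2 : ∫ x in Ω, φ x *
        inner ℝ (((0 : Lp (Eucl N) ∞ (leb Ω)) : Eucl N → Eucl N) x) v = 0 := by
      rw [← integral_zero (Eucl N) ℝ (μ := leb Ω)]
      refine integral_congr_ae ?_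
      filter_upwards [Lp.coeFn_zero (Eucl N) ∞ (leb Ω)] with x hx
      rw [hx]
      simp
    exact h1.trans (by rw [← neg_zero, ← h2]; rfl)
  add_mem' := by
    rintro ⟨u, g⟩ ⟨u', g'⟩ h h' φ hφ hc hs v
    have e1 : ∫ x in Ω, (u + u' : Lp ℝ ∞ (leb Ω)) x * fderiv ℝ φ x v
        = (∫ x in Ω, u x * fderiv ℝ φ x v) + ∫ x in Ω, u' x * fderiv ℝ φ x v := by
      obtain ⟨c1, c2⟩ := test_fderiv hφ hc v
      rw [← integral_add (integrable_mul_of_memLp_top (Lp.memLp u) c1 c2)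
        (integrable_mul_of_memLp_top (Lp.memLp u') c1 c2)]
      refine integral_congr_ae ?_
      filter_upwards [Lp.coeFn_add u u'] with x hx
      rw [hx, Pi.add_apply, add_mul]
    have e2 : ∫ x in Ω, φ x * inner ℝ ((g + g' : Lp (Eucl N) ∞ (leb Ω)) x) v
        = (∫ x in Ω, φ x * inner ℝ (g x) v) + ∫ x in Ω, φ x * inner ℝ (g' x) v := by
      have i1 := integrable_mul_of_memLp_top (memLp_inner_const (Lp.memLp g) v) hφ.continuous hc
      have i2 := integrable_mul_of_memLp_top (memLp_inner_const (Lp.memLp g') v) hφ.continuous hc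
      simp only [mul_comm _ (φ _)] at i1 i2
      rw [← integral_add i1 i2]
      refine integral_congr_ae ?_
      filter_upwards [Lp.coeFn_add g g'] with x hx
      rw [hx, Pi.add_apply, inner_add_left, mul_add]
    have a1 := h φ hφ hc hs v
    have a2 := h' φ hφ hc hs v
    simp only at a1 a2
    simp only [Prod.mk_add_mk]
    rw [e1, e2, a1, a2]
    ring
  smul_mem' := by
    rintro c ⟨u, g⟩ h φ hφ hc hs v
    have e1 : ∫ x in Ω, (c • u : Lp ℝ ∞ (leb Ω)) x * fderiv ℝ φ x v
        = c * ∫ x in Ω, u x * fderiv ℝ φ x v := by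
      rw [← integral_const_mul]
      refine integral_congr_ae ?_
      filter_upwards [Lp.coeFn_smul c u] with x hx
      rw [hx, Pi.smul_apply, smul_eq_mul, mul_assoc]
    have e2 : ∫ x in Ω, φ x * inner ℝ ((c • g : Lp (Eucl N) ∞ (leb Ω)) x) v
        = c * ∫ x in Ω, φ x * inner ℝ (g x) v := by
      rw [← integral_const_mul]
      refine integral_congr_ae ?_
      filter_upwards [Lp.coeFn_smul c g] with x hx
      rw [hx, Pi.smul_apply, real_inner_smul_left, mul_left_comm]
    have a1 := h φ hφ hc hs v
    simp only at a1
    simp only [Prod.smul_mk]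
    rw [e1, e2, a1]
    ring

/-- The (weak) gradient `Du : Ω → ℝ^N` of `u ∈ W^{1,∞}(Ω)`. -/
def grad {Ω : Set (Eucl N)} (u : W1inf Ω) : Eucl N → Eucl N := u.1.2

/-- The topology `τ_∞` on `W^{1,∞}(Ω)`, induced by the inclusion `W^{1,∞}(Ω) ⊆ L^∞(Ω)`. -/
abbrev tauInf (Ω : Set (Eucl N)) : TopologicalSpace (W1inf Ω) :=
  TopologicalSpace.induced (fun u => u.1.1) inferInstance

/-- The map `L^∞(Ω) × L^∞(Ω; ℝ^N) → L^1(Ω)' × L^1(Ω; ℝ^N)'` given by the pairings `∫_Ω u h` and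
`∫_Ω g · k`, both duals carrying their weak* topologies. -/
def toDual (Ω : Set (Eucl N)) (p : Lp ℝ ∞ (leb Ω) × Lp (Eucl N) ∞ (leb Ω)) :
    WeakDual ℝ (Lp ℝ 1 (leb Ω)) × WeakDual ℝ (Lp (Eucl N) 1 (leb Ω)) :=
  (StrongDual.toWeakDual ((ContinuousLinearMap.mul ℝ ℝ).lpPairing (leb Ω) ∞ 1 p.1),
   StrongDual.toWeakDual ((innerSL ℝ (E := Eucl N)).lpPairing (leb Ω) ∞ 1 p.2))

/-- The weak* topology on `W^{1,∞}(Ω)`, inherited from `L^∞(Ω) × L^∞(Ω; ℝ^N)` with the weak*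
topology as the dual of `L^1(Ω) × L^1(Ω; ℝ^N)`. -/
abbrev weakStar (Ω : Set (Eucl N)) : TopologicalSpace (W1inf Ω) :=
  TopologicalSpace.induced (fun u => toDual Ω u.1) inferInstance

/-- A finite union of sequentially closed sets is sequentially closed. -/
theorem isSeqClosed_union {X : Type*} [TopologicalSpace X] {A B : Set X}
    (hA : IsSeqClosed A) (hB : IsSeqClosed B) : IsSeqClosed (A ∪ B) := by
  intro x p hx hp
  by_cases h : ∃ᶠ n in atTop, x n ∈ A
  · obtain ⟨ψ, hψ, hm⟩ := extraction_of_frequently_atTop h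
    exact Or.inl (hA hm (hp.comp hψ.tendsto_atTop))
  · have h2 : ∃ᶠ n in atTop, x n ∈ B := by
      rw [not_frequently] at h
      exact (h.mono fun n hn => (hx n).resolve_left hn).frequently
    obtain ⟨ψ, hψ, hm⟩ := extraction_of_frequently_atTop h2
    exact Or.inr (hB hm (hp.comp hψ.tendsto_atTop))

/-- The topology `t_seq` whose closed sets are the sequentially `t`-closed sets. -/
abbrev seqTopology {X : Type*} (t : TopologicalSpace X) : TopologicalSpace X :=
  TopologicalSpace.ofClosed {s | IsSeqClosed s}
    (fun _ _ h _ => (h 0).elim)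
    (fun _ hA _ _ hx hp s hs => hA hs (fun n => hx n s hs) hp)
    (fun _ hA _ hB => isSeqClosed_union hA hB)

/-- The closed sets of `seqTopology t` are exactly the sequentially `t`-closed sets. -/
theorem isClosed_seqTopology_iff {X : Type*} (t : TopologicalSpace X) (s : Set X) :
    IsClosed[seqTopology t] s ↔ @IsSeqClosed X t s := by
  rw [← @isOpen_compl_iff X s (seqTopology t)]
  change IsSeqClosed sᶜᶜ ↔ _
  rw [compl_compl]

/-- `F` is `τ`-lower semicontinuous: for every real `c` the sublevel set `{F ≤ c}` is
`τ`-closed. -/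
def IsLSC {X : Type*} (τ : TopologicalSpace X) (F : X → EReal) : Prop :=
  ∀ c : ℝ, IsClosed[τ] {u | F u ≤ (c : EReal)}

/-- `F` is level convex: `F (θ x₁ + (1 - θ) x₂) ≤ F x₁ ∨ F x₂` for all `θ ∈ (0, 1)`. -/
def LevelConvex {X : Type*} [AddCommGroup X] [Module ℝ X] (F : X → EReal) : Prop :=
  ∀ θ : ℝ, 0 < θ → θ < 1 → ∀ x₁ x₂ : X, F (θ • x₁ + (1 - θ) • x₂) ≤ F x₁ ⊔ F x₂

/-- The localized supremal functional `F(u, A) = ess sup_{x ∈ A} f(x, Du(x))`, for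
`u ∈ W^{1,∞}(Ω)` and `A ⊆ Ω` open (the essential supremum over the empty set is `-∞`). -/
def supremal (f : Eucl N → Eucl N → EReal) {Ω : Set (Eucl N)} (u : W1inf Ω)
    (A : Set (Eucl N)) : EReal :=
  essSup (fun x => f x (grad u x)) (leb A)

theorem memLp_linear {Ω : Set (Eucl N)} (hΩ : IsOpen Ω) (hb : Bornology.IsBounded Ω)
    (ξ : Eucl N) : MemLp (fun x : Eucl N => inner ℝ ξ x) ∞ (leb Ω) := by
  obtain ⟨C, hC⟩ := hb.exists_norm_le
  refine memLp_top_of_bound (by fun_prop) (‖ξ‖ * C) ?_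
  filter_upwards [ae_restrict_mem hΩ.measurableSet] with x hx
  exact (norm_inner_le_norm ξ x).trans
    (mul_le_mul_of_nonneg_left (hC x hx) (norm_nonneg _))

theorem hasWeakGradient_linear {Ω : Set (Eucl N)} (ξ : Eucl N) :
    HasWeakGradient Ω (fun x => inner ℝ ξ x) (fun _ => ξ) := by
  intro φ hφ hc hs v
  have hφ0 : ∀ x, x ∉ Ω → φ x = 0 := fun x hx =>
    image_eq_zero_of_notMem_tsupport fun h => hx (hs h)
  have hd0 : ∀ x, x ∉ Ω → fderiv ℝ φ x v = 0 := fun x hx => by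
    rw [fderiv_of_notMem_tsupport ℝ fun h => hx (hs h)]
    simp
  rw [setIntegral_eq_integral_of_forall_compl_eq_zero (fun x hx => by simp [hd0 x hx]),
    setIntegral_eq_integral_of_forall_compl_eq_zero (fun x hx => by simp [hφ0 x hx])]
  obtain ⟨c1, c2⟩ := test_fderiv hφ hc v
  have hL : ∀ x, fderiv ℝ (fun x : Eucl N => (inner ℝ ξ x : ℝ)) x v = inner ℝ ξ v := fun x => by
    have : HasFDerivAt (fun x : Eucl N => (inner ℝ ξ x : ℝ)) (innerSL ℝ ξ) x :=
      (innerSL ℝ ξ).hasFDerivAt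
    rw [this.fderiv]
    rfl
  have hlin : Continuous (fun x : Eucl N => (inner ℝ ξ x : ℝ)) := by fun_prop
  rw [integral_mul_fderiv_eq_neg_fderiv_mul_of_integrable (μ := volume)
    (f := fun x : Eucl N => (inner ℝ ξ x : ℝ)) (g := φ) (v := v)]
  · congr 1
    refine integral_congr_ae (Eventually.of_forall fun x => ?_)
    simp only [hL]
    ring
  · simp only [hL]
    exact (continuous_const.mul hφ.continuous).integrable_of_hasCompactSupport hc.mul_left
  · exact (hlin.mul c1).integrable_of_hasCompactSupport c2.mul_left
  · exact (hlin.mul hφ.continuous).integrable_of_hasCompactSupport hc.mul_left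
  · exact fun x _ => ((innerSL ℝ ξ).differentiableAt : DifferentiableAt ℝ (innerSL ℝ ξ) x)
  · exact fun x _ => (hφ.differentiable (by simp)) x

/-- The linear function `u_ξ(x) = ξ · x` as an element of `W^{1,∞}(Ω)`, `Ω` open and bounded. -/
def linearFn {Ω : Set (Eucl N)} (hΩ : IsOpen Ω) (hb : Bornology.IsBounded Ω) (ξ : Eucl N) :
    W1inf Ω :=
  ⟨((memLp_linear hΩ hb ξ).toLp,
    (memLp_top_const (μ := leb Ω) ξ).toLp), by
    intro φ hφ hc hs v
    refine Eq.trans (integral_congr_ae ?_)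
      ((hasWeakGradient_linear ξ φ hφ hc hs v).trans (congrArg Neg.neg (integral_congr_ae ?_)))
    · filter_upwards [(memLp_linear hΩ hb ξ).coeFn_toLp] with x hx
      simp [hx]
    · filter_upwards [(memLp_top_const (μ := leb Ω) ξ).coeFn_toLp] with x hx
      simp [hx]⟩

/-- Condition `(H_Ω)` for a functional `F` on `W^{1,∞}(Ω)`, `Ω` open and bounded: there is a
sequence `u_n` in `W^{1,∞}(Ω)` with `F(u_n) → inf F` and, for every `n`,
`limsup_{ξ → 0} F(u_n + u_ξ) = F(u_n)`. -/
def HypH {Ω : Set (Eucl N)} (hΩ : IsOpen Ω) (hb : Bornology.IsBounded Ω)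
    (F : W1inf Ω → EReal) : Prop :=
  ∃ u : ℕ → W1inf Ω,
    Tendsto (fun n => F (u n)) atTop (𝓝 (⨅ w, F w)) ∧
    ∀ n, limsup (fun ξ : Eucl N => F (u n + linearFn hΩ hb ξ)) (𝓝 0) = F (u n)

end Supremal

end

/-!
Level convexity of supremal functionals whose localizations to balls are lower semicontinuous.

Let `w = u₁ - u₂` and `θ ∈ (0, 1)`. The line `t ↦ θ t` is a uniform limit of Lipschitz functions
`h n` with `h n 0 = 0` and slopes in `{0, 1}`: take for `h n` a primitive of the indicator of a
closed periodic set of density `θ` and small period (`exists_isClosed_integral_indicator_near`).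
Since `u₁` and `u₂` are real valued, the chain rule (`HasWeakGradient.comp_integral_indicator`)
shows that the gradient of `u₂ + h n ∘ w` is at almost every point either `Du₁` or `Du₂`, so that
`F(u₂ + h n ∘ w, B) ≤ max (F(u₁, B)) (F(u₂, B))`.

These functions converge to `u₂ + θ w = θ u₁ + (1 - θ) u₂` in `L^∞(Ω)`, and their gradients are
bounded. Hence they converge also weakly*, by integration by parts and the density in `L¹(Ω)` of
test functions, and the limit belongs to every closed set containing the sequence, for each of the
three topologies (`mem_of_isClosed_of_tendsto`). Lower semicontinuity on the ball `B` thus gives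
the inequality there (`supremal_ball_le`), and it passes to
an open set `A` because essential bounds are local (`ae_restrict_of_ball`).
-/

namespace Supremal

variable {N : ℕ}

/-! ### Mollification and the chain rule -/

open Convolution ContinuousLinearMap in
theorem abs_normed_convolution_le (ψ : ContDiffBump (0 : Eucl N)) {w : Eucl N → ℝ} {C : ℝ}
    (hw : ∀ᵐ x, |w x| ≤ C) (x : Eucl N) :
    |(ψ.normed volume ⋆[lsmul ℝ ℝ, volume] w) x| ≤ C := by
  have hint : Integrable (fun t => ψ.normed volume (x - t)) :=
    ψ.integrable_normed.comp_sub_left x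
  rw [convolution_eq_swap, ← Real.norm_eq_abs]
  calc ‖∫ t, (lsmul ℝ ℝ) (ψ.normed volume (x - t)) (w t)‖
      ≤ ∫ t, ψ.normed volume (x - t) * C := by
        refine norm_integral_le_of_norm_le (hint.mul_const C) ?_
        filter_upwards [hw] with t ht
        rw [lsmul_apply, smul_eq_mul, norm_mul, Real.norm_of_nonneg (ψ.nonneg_normed _)]
        exact mul_le_mul_of_nonneg_left ht (ψ.nonneg_normed _)
    _ = C := by
        rw [integral_mul_const, integral_sub_left_eq_self (fun t => ψ.normed volume t),
          ψ.integral_normed, one_mul]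

open Convolution ContinuousLinearMap in
/-- Mollification commutes with weak differentiation at distance more than the mollification
radius from the complement of `Ω`. -/
theorem HasWeakGradient.fderiv_convolution {Ω : Set (Eucl N)} {u : Eucl N → ℝ}
    {g : Eucl N → Eucl N} (hΩ : IsOpen Ω) (h : HasWeakGradient Ω u g)
    (hu : LocallyIntegrable (Ω.indicator u))
    (ψ : ContDiffBump (0 : Eucl N)) {x : Eucl N} (hx : Metric.closedBall x ψ.rOut ⊆ Ω)
    (v : Eucl N) :
    fderiv ℝ (ψ.normed volume ⋆[lsmul ℝ ℝ, volume] Ω.indicator u) x v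
      = (ψ.normed volume ⋆[lsmul ℝ ℝ, volume] Ω.indicator (fun y => inner ℝ (g y) v)) x := by
  have hρ : ContDiff ℝ ∞ (ψ.normed volume) := ψ.contDiff_normed
  have hρc : HasCompactSupport (ψ.normed volume) := ψ.hasCompactSupport_normed
  rw [(hρc.hasFDerivAt_convolution_left (lsmul ℝ ℝ) (hρ.of_le (by simp)) hu x).fderiv]
  have hex : ConvolutionExistsAt (fderiv ℝ (ψ.normed volume)) (Ω.indicator u) x
      ((lsmul ℝ ℝ).precompL (Eucl N)) volume :=
    (hρc.fderiv ℝ).convolutionExists_left _ (hρ.continuous_fderiv (by simp)) hu x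
  rw [convolution_eq_swap, convolution_eq_swap,
    ContinuousLinearMap.integral_apply hex.integrable_swap]
  -- the test function is the reflected and translated kernel
  set φ : Eucl N → ℝ := fun y => ψ.normed volume (x - y) with hφdef
  have hsub : ContDiff ℝ ∞ (fun y : Eucl N => x - y) := contDiff_const.sub contDiff_id
  have hφ : ContDiff ℝ ∞ φ := hρ.comp hsub
  have hφc : HasCompactSupport φ := hρc.comp_homeomorph (Homeomorph.subLeft x)
  have hφs : tsupport φ ⊆ Ω := by
    refine subset_trans (closure_minimal ?_ Metric.isClosed_closedBall) hx
    intro y hy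
    have : x - y ∈ Function.support (ψ.normed volume) := hy
    rw [ψ.support_normed_eq] at this
    rw [Metric.mem_closedBall, dist_comm, dist_eq_norm]
    simpa using (Metric.mem_ball.1 this).le
  have hφd : ∀ y, fderiv ℝ φ y v = - fderiv ℝ (ψ.normed volume) (x - y) v := by
    intro y
    have h1 : HasFDerivAt φ
        ((fderiv ℝ (ψ.normed volume) (x - y)).comp (-ContinuousLinearMap.id ℝ (Eucl N))) y :=
      ((hρ.differentiable (by simp) (x - y)).hasFDerivAt).comp y ((hasFDerivAt_id y).const_sub x)
    rw [h1.fderiv]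
    simp
  have key := h φ hφ hφc hφs v
  rw [← integral_indicator hΩ.measurableSet, ← integral_indicator hΩ.measurableSet] at key
  have e1 : ∀ t, ((lsmul ℝ ℝ).precompL (Eucl N) (fderiv ℝ (ψ.normed volume) (x - t))
      (Ω.indicator u t)) v = - Ω.indicator (fun y => u y * fderiv ℝ φ y v) t := by
    intro t
    by_cases ht : t ∈ Ω <;> simp [ht, hφd, precompL_apply, mul_comm]
  have e2 : ∀ t, (lsmul ℝ ℝ) (ψ.normed volume (x - t))
      (Ω.indicator (fun y => inner ℝ (g y) v) t)
        = Ω.indicator (fun y => φ y * inner ℝ (g y) v) t := by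
    intro t
    by_cases ht : t ∈ Ω <;> simp [ht, hφdef]
  simp only [e1, e2]
  rw [integral_neg, key, neg_neg]

/-- Dominated convergence for a bounded sequence tested against a fixed integrable function. -/
theorem tendsto_setIntegral_mul_of_ae_bdd {Ω : Set (Eucl N)} {f : ℕ → Eucl N → ℝ}
    {f₀ ζ : Eucl N → ℝ} {C : ℝ} (hf : ∀ n, AEStronglyMeasurable (f n) (leb Ω))
    (hC : ∀ n, ∀ᵐ x ∂(leb Ω), |f n x| ≤ C)
    (hlim : ∀ᵐ x ∂(leb Ω), Tendsto (fun n => f n x) atTop (𝓝 (f₀ x)))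
    (hζ : Integrable ζ (leb Ω)) :
    Tendsto (fun n => ∫ x in Ω, f n x * ζ x) atTop (𝓝 (∫ x in Ω, f₀ x * ζ x)) := by
  refine tendsto_integral_of_dominated_convergence (fun x => C * ‖ζ x‖)
    (fun n => (hf n).mul hζ.aestronglyMeasurable) (hζ.norm.const_mul C) (fun n => ?_) ?_
  · filter_upwards [hC n] with x hx
    rw [norm_mul]
    exact mul_le_mul_of_nonneg_right hx (norm_nonneg _)
  · filter_upwards [hlim] with x hx
    exact hx.mul_const _

open Convolution ContinuousLinearMap in
/-- Chain rule for `W^{1,∞}` functions and outer functions of class `C¹`: integrate by parts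
with the mollifications `w n` of `u`, then let the mollification radius tend to zero. -/
theorem HasWeakGradient.comp_of_hasDerivAt {Ω : Set (Eucl N)} (hΩ : IsOpen Ω)
    {u : Eucl N → ℝ} {g : Eucl N → Eucl N} (h : HasWeakGradient Ω u g)
    (hu : MemLp u ∞ (leb Ω)) (hg : MemLp g ∞ (leb Ω)) {H q : ℝ → ℝ} (hq : Continuous q)
    (hH : ∀ t, HasDerivAt H (q t) t) :
    HasWeakGradient Ω (fun x => H (u x)) (fun x => q (u x) • g x) := by
  intro φ hφ hc hs v
  have hgv := memLp_inner_const hg v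
  set U : Eucl N → ℝ := Ω.indicator u with hUdef
  set G : Eucl N → ℝ := Ω.indicator (fun y => inner ℝ (g y) v) with hGdef
  have hUp : MemLp U ∞ volume := (memLp_indicator_iff_restrict hΩ.measurableSet).2 hu
  have hGp : MemLp G ∞ volume := (memLp_indicator_iff_restrict hΩ.measurableSet).2 hgv
  have hUl : LocallyIntegrable U := hUp.locallyIntegrable le_top
  have hGl : LocallyIntegrable G := hGp.locallyIntegrable le_top
  obtain ⟨A, hA⟩ : ∃ A, ∀ᵐ x, |U x| ≤ A := ⟨_, ae_le_lpNorm_exponent_top hUp⟩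
  obtain ⟨B, hB⟩ : ∃ A, ∀ᵐ x, |G x| ≤ A :=
    ⟨_, ae_le_lpNorm_exponent_top hGp⟩
  obtain ⟨δ, hδ, hδΩ⟩ := IsCompact.exists_cthickening_subset_open hc hΩ hs
  let ψ : ℕ → ContDiffBump (0 : Eucl N) := fun n =>
    { rIn := δ / (2 * (n + 1)), rOut := δ / (n + 1)
      rIn_pos := by positivity
      rIn_lt_rOut := by
        apply div_lt_div_of_pos_left hδ (by positivity)
        have : (0 : ℝ) < n + 1 := by positivity
        linarith }
  have hψlim : Tendsto (fun n => (ψ n).rOut) atTop (𝓝 0) := by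
    have := (tendsto_one_div_add_atTop_nhds_zero_nat (𝕜 := ℝ)).const_mul δ
    simpa [ψ, div_eq_mul_inv] using this
  have hψK : ∀ᶠ n in atTop, (ψ n).rOut ≤ 2 * (ψ n).rIn := by
    refine Eventually.of_forall fun n => le_of_eq ?_
    simp only [ψ]
    field_simp
  set w : ℕ → Eucl N → ℝ := fun n => (ψ n).normed volume ⋆[lsmul ℝ ℝ, volume] U with hw
  set G' : ℕ → Eucl N → ℝ := fun n => (ψ n).normed volume ⋆[lsmul ℝ ℝ, volume] G with hG'
  have hwC : ∀ n, ContDiff ℝ 1 (w n) := fun n =>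
    (ψ n).hasCompactSupport_normed.contDiff_convolution_left _ (ψ n).contDiff_normed hUl
  have hGC : ∀ n, Continuous (G' n) := fun n =>
    ((ψ n).hasCompactSupport_normed.contDiff_convolution_left (n := 1) _
      (ψ n).contDiff_normed hGl).continuous
  have hwA : ∀ n x, |w n x| ≤ A := fun n x => abs_normed_convolution_le (ψ n) hA x
  have hGB : ∀ n x, |G' n x| ≤ B := fun n x => abs_normed_convolution_le (ψ n) hB x
  have hwlim : ∀ᵐ x ∂(leb Ω), Tendsto (fun n => w n x) atTop (𝓝 (u x)) := by
    filter_upwards [ae_restrict_of_ae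
      (ContDiffBump.ae_convolution_tendsto_right_of_locallyIntegrable hψlim hψK hUl),
      ae_restrict_mem hΩ.measurableSet] with x hx hxΩ
    simpa [hUdef, hxΩ] using hx
  have hGlim : ∀ᵐ x ∂(leb Ω), Tendsto (fun n => G' n x) atTop (𝓝 (inner ℝ (g x) v)) := by
    filter_upwards [ae_restrict_of_ae
      (ContDiffBump.ae_convolution_tendsto_right_of_locallyIntegrable hψlim hψK hGl),
      ae_restrict_mem hΩ.measurableSet] with x hx hxΩ
    simpa [hGdef, hxΩ] using hx
  have hHc : Continuous H := continuous_iff_continuousAt.2 fun t => (hH t).continuousAt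
  -- the mollifications take their values in `[-A, A]`, where `H` and `q` are bounded
  obtain ⟨CH, hCH⟩ := isCompact_Icc.exists_bound_of_continuousOn (s := Set.Icc (-A) A)
    hHc.continuousOn
  obtain ⟨Cq, hCq⟩ := isCompact_Icc.exists_bound_of_continuousOn (s := Set.Icc (-A) A)
    hq.continuousOn
  obtain ⟨c1, c2⟩ := test_fderiv hφ hc v
  have hφ0 : ∀ x, x ∉ Ω → φ x = 0 := fun x hx =>
    image_eq_zero_of_notMem_tsupport fun h => hx (hs h)
  have hd0 : ∀ x, x ∉ Ω → fderiv ℝ φ x v = 0 := fun x hx => by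
    rw [fderiv_of_notMem_tsupport ℝ fun h => hx (hs h)]
    simp
  -- integration by parts for the smooth `H ∘ w n`; the radius is at most `δ`, so on the support
  -- of `φ` the gradient of `w n` is the mollified weak gradient
  have hstep : ∀ n, ∫ x in Ω, H (w n x) * fderiv ℝ φ x v
      = - ∫ x in Ω, (q (w n x) * G' n x) * φ x := by
    intro n
    have hder : ∀ x, fderiv ℝ (fun y => H (w n y)) x v = q (w n x) * fderiv ℝ (w n) x v := by
      intro x
      have h1 := (hH (w n x)).comp_hasFDerivAt x
        (((hwC n).differentiable (by simp)) x).hasFDerivAt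
      have h2 : fderiv ℝ (fun y => H (w n y)) x = q (w n x) • fderiv ℝ (w n) x := h1.fderiv
      rw [h2]
      rfl
    have hdw : ∀ x, fderiv ℝ (w n) x v * φ x = G' n x * φ x := by
      intro x
      by_cases hx : x ∈ tsupport φ
      · rw [h.fderiv_convolution hΩ hUl (ψ n) ?_ v]
        refine subset_trans ?_ hδΩ
        refine subset_trans (Metric.closedBall_subset_cthickening hx _)
          (Metric.cthickening_mono ?_ _)
        exact div_le_self hδ.le (by simp)
      · rw [image_eq_zero_of_notMem_tsupport hx, mul_zero, mul_zero]
    have hdwc : Continuous fun x => fderiv ℝ (w n) x v :=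
      ((hwC n).continuous_fderiv (by simp)).clm_apply continuous_const
    have hHw : Continuous fun x => H (w n x) := hHc.comp (hwC n).continuous
    have hqw : Continuous fun x => q (w n x) := hq.comp (hwC n).continuous
    rw [setIntegral_eq_integral_of_forall_compl_eq_zero (fun x hx => by simp [hd0 x hx]),
      setIntegral_eq_integral_of_forall_compl_eq_zero (fun x hx => by simp [hφ0 x hx]),
      integral_mul_fderiv_eq_neg_fderiv_mul_of_integrable (μ := volume)
        (f := fun y => H (w n y)) (g := φ) (v := v)]
    · congr 1
      refine integral_congr_ae (Eventually.of_forall fun x => ?_)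
      simp only [hder, mul_assoc, hdw]
    · simp only [hder]
      exact ((hqw.mul hdwc).mul hφ.continuous).integrable_of_hasCompactSupport hc.mul_left
    · exact (hHw.mul c1).integrable_of_hasCompactSupport c2.mul_left
    · exact (hHw.mul hφ.continuous).integrable_of_hasCompactSupport hc.mul_left
    · exact fun x _ => (hH _).differentiableAt.comp x ((hwC n).differentiable (by simp) x)
    · exact fun x _ => (hφ.differentiable (by simp)) x
  have hL := tendsto_setIntegral_mul_of_ae_bdd (Ω := Ω) (C := CH) (f := fun n x => H (w n x))
    (f₀ := fun x => H (u x)) (fun n => (hHc.comp (hwC n).continuous).aestronglyMeasurable)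
    (fun n => Eventually.of_forall fun x => hCH _ (abs_le.1 (hwA n x)))
    (hwlim.mono fun x hx => (hHc.tendsto _).comp hx)
    (c1.integrable_of_hasCompactSupport c2)
  have hR := tendsto_setIntegral_mul_of_ae_bdd (Ω := Ω) (C := Cq * B)
    (f := fun n x => q (w n x) * G' n x)
    (f₀ := fun x => q (u x) * inner ℝ (g x) v)
    (fun n => ((hq.comp (hwC n).continuous).mul (hGC n)).aestronglyMeasurable)
    (fun n => Eventually.of_forall fun x => by
      rw [abs_mul]
      exact mul_le_mul (hCq _ (abs_le.1 (hwA n x))) (hGB n x) (abs_nonneg _)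
        ((norm_nonneg _).trans (hCq _ (abs_le.1 (hwA n x)))))
    (by filter_upwards [hwlim, hGlim] with x hx hx'
        exact ((hq.tendsto _).comp hx).mul hx')
    (hφ.continuous.integrable_of_hasCompactSupport hc)
  rw [tendsto_nhds_unique hL (by simpa only [hstep] using hR.neg)]
  congr 1
  refine integral_congr_ae (Eventually.of_forall fun x => ?_)
  simp only [real_inner_smul_left]
  ring

/-- Chain rule for `W^{1,∞}` functions and a primitive of the indicator of a closed set `E`.
The indicator is the pointwise limit of continuous functions `q n` with values in `[0, 1]`, to
which the `C¹` chain rule applies. Working with an indicator that is defined everywhere makes the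
usual remark that `∇u = 0` almost everywhere on the level sets of `u` unnecessary. -/
theorem HasWeakGradient.comp_integral_indicator {Ω : Set (Eucl N)} (hΩ : IsOpen Ω)
    {u : Eucl N → ℝ} {g : Eucl N → Eucl N} (h : HasWeakGradient Ω u g)
    (hu : MemLp u ∞ (leb Ω)) (hg : MemLp g ∞ (leb Ω)) {E : Set ℝ} (hE : IsClosed E) :
    HasWeakGradient Ω (fun x => ∫ t in (0 : ℝ)..u x, E.indicator (fun _ => (1 : ℝ)) t)
      (fun x => E.indicator (fun _ => (1 : ℝ)) (u x) • g x) := by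
  intro φ hφ hc hs v
  have hδ : ∀ n : ℕ, (0 : ℝ) < 1 / ((n : ℝ) + 1) := fun n => by positivity
  let q : ℕ → ℝ → ℝ := fun n t => (thickenedIndicator (hδ n) E t : ℝ)
  have hqc : ∀ n, Continuous (q n) := fun n =>
    NNReal.continuous_coe.comp (thickenedIndicator (hδ n) E).continuous
  have hq1 : ∀ n t, ‖q n t‖ ≤ 1 := fun n t => by
    rw [Real.norm_of_nonneg (NNReal.coe_nonneg _)]
    exact_mod_cast thickenedIndicator_le_one (hδ n) E t
  have hqlim : ∀ t, Tendsto (fun n => q n t) atTop (𝓝 (E.indicator (fun _ => (1 : ℝ)) t)) := by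
    intro t
    have := tendsto_pi_nhds.1 (thickenedIndicator_tendsto_indicator_closure hδ
      (tendsto_one_div_add_atTop_nhds_zero_nat (𝕜 := ℝ)) E) t
    rw [hE.closure_eq] at this
    have h2 := (NNReal.continuous_coe.tendsto _).comp this
    have e : E.indicator (fun _ => (1 : ℝ)) t
        = ((E.indicator (fun _ => (1 : NNReal)) t : NNReal) : ℝ) := by
      by_cases ht : t ∈ E <;> simp [ht]
    rw [e]
    exact h2
  have hQc : ∀ n, Continuous fun s => ∫ t in (0 : ℝ)..s, q n t := fun n =>
    intervalIntegral.continuous_primitive (fun a b => (hqc n).intervalIntegrable a b) 0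
  have hQlim : ∀ s, Tendsto (fun n => ∫ t in (0 : ℝ)..s, q n t) atTop
      (𝓝 (∫ t in (0 : ℝ)..s, E.indicator (fun _ => (1 : ℝ)) t)) := fun s =>
    intervalIntegral.tendsto_integral_filter_of_dominated_convergence (fun _ => 1)
      (Eventually.of_forall fun n => (hqc n).aestronglyMeasurable)
      (Eventually.of_forall fun n => Eventually.of_forall fun t _ => hq1 n t)
      intervalIntegrable_const (Eventually.of_forall fun t _ => hqlim t)
  have hgv := memLp_inner_const hg v
  obtain ⟨c1, c2⟩ := test_fderiv hφ hc v
  have hstep : ∀ n, ∫ x in Ω, (∫ t in (0 : ℝ)..u x, q n t) * fderiv ℝ φ x v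
      = - ∫ x in Ω, (q n (u x) * inner ℝ (g x) v) * φ x := by
    intro n
    rw [h.comp_of_hasDerivAt hΩ hu hg (hqc n)
      (fun t => (hqc n).integral_hasStrictDerivAt 0 t |>.hasDerivAt) φ hφ hc hs v]
    congr 1
    refine integral_congr_ae (Eventually.of_forall fun x => ?_)
    simp only [real_inner_smul_left]
    ring
  have hL := tendsto_setIntegral_mul_of_ae_bdd (Ω := Ω) (C := lpNorm u ∞ (leb Ω))
    (f := fun n x => ∫ t in (0 : ℝ)..u x, q n t)
    (f₀ := fun x => ∫ t in (0 : ℝ)..u x, E.indicator (fun _ => (1 : ℝ)) t)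
    (fun n => (hQc n).comp_aestronglyMeasurable hu.aestronglyMeasurable)
    (fun n => (ae_le_lpNorm_exponent_top hu).mono fun x hx => by
      refine (intervalIntegral.norm_integral_le_of_norm_le_const
        (C := 1) fun t _ => hq1 n t).trans ?_
      simpa using hx)
    (Eventually.of_forall fun x => hQlim _) (c1.integrable_of_hasCompactSupport c2)
  have hR := tendsto_setIntegral_mul_of_ae_bdd (Ω := Ω)
    (C := lpNorm (fun x => (inner ℝ (g x) v : ℝ)) ∞ (leb Ω))
    (f := fun n x => q n (u x) * inner ℝ (g x) v)
    (f₀ := fun x => E.indicator (fun _ => (1 : ℝ)) (u x) * inner ℝ (g x) v)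
    (fun n => ((hqc n).comp_aestronglyMeasurable hu.aestronglyMeasurable).mul
      hgv.aestronglyMeasurable)
    (fun n => (ae_le_lpNorm_exponent_top hgv).mono fun x hx => by
      rw [abs_mul]
      exact (mul_le_of_le_one_left (abs_nonneg _) (hq1 n _)).trans hx)
    (Eventually.of_forall fun x => (hqlim _).mul_const _)
    (hφ.continuous.integrable_of_hasCompactSupport hc)
  rw [tendsto_nhds_unique hL (by simpa only [hstep] using hR.neg)]
  congr 1
  refine integral_congr_ae (Eventually.of_forall fun x => ?_)
  simp only [real_inner_smul_left]
  ring

theorem HasWeakGradient.congr_ae {Ω : Set (Eucl N)} {u u' : Eucl N → ℝ} {g g' : Eucl N → Eucl N}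
    (h : HasWeakGradient Ω u g) (hu : u' =ᵐ[leb Ω] u) (hg : g' =ᵐ[leb Ω] g) :
    HasWeakGradient Ω u' g' := by
  intro φ hφ hc hs v
  refine Eq.trans (integral_congr_ae ?_)
    ((h φ hφ hc hs v).trans (congrArg Neg.neg (integral_congr_ae ?_)))
  · filter_upwards [hu] with x hx
    rw [hx]
  · filter_upwards [hg] with x hx
    rw [hx]

/-- The composition of `w` with a primitive of `1_E`, as an element of `W^{1,∞}(Ω)`; its gradient
takes the values `0` and `Dw` only. -/
theorem W1inf.exists_comp_integral_indicator {Ω : Set (Eucl N)} (hΩ : IsOpen Ω) (w : W1inf Ω)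
    {E : Set ℝ} (hE : IsClosed E) :
    ∃ z : W1inf Ω,
      (∀ᵐ x ∂(leb Ω), z.1.1 x = ∫ t in (0 : ℝ)..w.1.1 x, E.indicator (fun _ => (1 : ℝ)) t) ∧
      (∀ᵐ x ∂(leb Ω), grad z x = E.indicator (fun _ => (1 : ℝ)) (w.1.1 x) • grad w x) := by
  have hE1 : ∀ t, ‖E.indicator (fun _ => (1 : ℝ)) t‖ ≤ 1 := fun t => by
    by_cases ht : t ∈ E <;> simp [ht]
  have hint : ∀ a b : ℝ, IntervalIntegrable (E.indicator fun _ => (1 : ℝ)) volume a b :=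
    fun a b => by
      have h1 : IntervalIntegrable (fun _ : ℝ => (1 : ℝ)) volume a b := intervalIntegrable_const
      exact ⟨h1.1.indicator hE.measurableSet, h1.2.indicator hE.measurableSet⟩
  have hu : MemLp (fun x => ∫ t in (0 : ℝ)..w.1.1 x, E.indicator (fun _ => (1 : ℝ)) t) ∞
      (leb Ω) := by
    refine (Lp.memLp w.1.1).of_le ((intervalIntegral.continuous_primitive hint
      0).comp_aestronglyMeasurable (Lp.aestronglyMeasurable _)) (Eventually.of_forall fun x => ?_)
    refine (intervalIntegral.norm_integral_le_of_norm_le_const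
        (C := 1) fun t _ => hE1 t).trans ?_
    simp
  have hg : MemLp (fun x => E.indicator (fun _ => (1 : ℝ)) (w.1.1 x) • grad w x) ∞ (leb Ω) := by
    have hm : AEMeasurable (fun x => E.indicator (fun _ => (1 : ℝ)) (w.1.1 x)) (leb Ω) :=
      (measurable_const.indicator hE.measurableSet).comp_aemeasurable
        (Lp.aestronglyMeasurable w.1.1).aemeasurable
    refine (Lp.memLp w.1.2).of_le (hm.aestronglyMeasurable.smul (Lp.aestronglyMeasurable w.1.2))
      (Eventually.of_forall fun x => ?_)
    rw [norm_smul]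
    exact mul_le_of_le_one_left (norm_nonneg _) (hE1 _)
  exact ⟨⟨(hu.toLp, hg.toLp), (HasWeakGradient.comp_integral_indicator hΩ w.2 (Lp.memLp _)
    (Lp.memLp _) hE).congr_ae hu.coeFn_toLp hg.coeFn_toLp⟩, hu.coeFn_toLp, hg.coeFn_toLp⟩

/-! ### Functions with slopes zero and one close to a line -/

/-- For `θ ∈ (0, 1)` the line `t ↦ θ t` is a uniform limit of functions with slopes in `{0, 1}`. -/
theorem exists_isClosed_integral_indicator_near {θ : ℝ} (h0 : 0 < θ) (h1 : θ < 1) {ε : ℝ}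
    (hε : 0 < ε) : ∃ E : Set ℝ, IsClosed E ∧
      ∀ t, |(∫ s in (0 : ℝ)..t, E.indicator (fun _ => (1 : ℝ)) s) - θ * t| ≤ ε := by
  -- the 1-periodic set of density `θ` consisting of the points at distance `≤ θ / 2` from `ℤ`
  let D : Set UnitAddCircle := Metric.closedBall 0 (θ / 2)
  let E₁ : Set ℝ := (fun t : ℝ => (t : UnitAddCircle)) ⁻¹' D
  have hE₁ : IsClosed E₁ := Metric.isClosed_closedBall.preimage (AddCircle.continuous_mk' 1)
  have hint : ∀ a b : ℝ, IntervalIntegrable (E₁.indicator fun _ => (1 : ℝ)) volume a b :=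
    fun a b => by
      have h1 : IntervalIntegrable (fun _ : ℝ => (1 : ℝ)) volume a b := intervalIntegrable_const
      exact ⟨h1.1.indicator hE₁.measurableSet, h1.2.indicator hE₁.measurableSet⟩
  have hper : ∀ t : ℝ, ∫ s in t..t + 1, E₁.indicator (fun _ => (1 : ℝ)) s = θ := by
    intro t
    have := UnitAddCircle.intervalIntegral_preimage t (D.indicator fun _ => (1 : ℝ))
    rw [integral_indicator_const _ Metric.isClosed_closedBall.measurableSet, measureReal_def,
      AddCircle.volume_closedBall, min_eq_right (by linarith),
      ENNReal.toReal_ofReal (by linarith)] at this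
    rw [show θ = (2 * (θ / 2)) • (1 : ℝ) by simp; ring, ← this]
    rfl
  -- the deviation from the line is periodic, hence bounded, and rescaling makes it small
  let p : ℝ → ℝ := fun t => (∫ s in (0 : ℝ)..t, E₁.indicator (fun _ => (1 : ℝ)) s) - θ * t
  have hp : Function.Periodic p 1 := fun t => by
    have := intervalIntegral.integral_add_adjacent_intervals (hint 0 t) (hint t (t + 1))
    simp only [p]
    rw [← this, hper]
    ring
  have hpc : Continuous p :=
    (intervalIntegral.continuous_primitive hint 0).sub (continuous_const.mul continuous_id)
  obtain ⟨C, hC⟩ := isCompact_Icc.exists_bound_of_continuousOn (s := Set.Icc (0 : ℝ) 1)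
    hpc.continuousOn
  have hC' : ∀ t, |p t| ≤ C := fun t => by
    rw [← (hp.sub_int_mul_eq ⌊t⌋ : p (t - ⌊t⌋ * 1) = p t), mul_one]
    exact hC _ ⟨Int.fract_nonneg t, (Int.fract_lt_one t).le⟩
  obtain ⟨n, hn⟩ := exists_nat_gt (C / ε)
  have hC0 : 0 ≤ C := (abs_nonneg _).trans (hC' 0)
  have hn0 : (0 : ℝ) < n := (div_nonneg hC0 hε.le).trans_lt hn
  refine ⟨(fun t : ℝ => n * t) ⁻¹' E₁, hE₁.preimage (by fun_prop), fun t => ?_⟩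
  have hcomp : ∫ s in (0 : ℝ)..t, ((fun t : ℝ => n * t) ⁻¹' E₁).indicator (fun _ => (1 : ℝ)) s
      = (n : ℝ)⁻¹ * ∫ s in (0 : ℝ)..n * t, E₁.indicator (fun _ => (1 : ℝ)) s := by
    have := intervalIntegral.integral_comp_mul_left (a := 0) (b := t)
      (E₁.indicator fun _ => (1 : ℝ)) hn0.ne'
    rw [mul_zero, smul_eq_mul] at this
    rw [← this]
    rfl
  rw [hcomp, show (n : ℝ)⁻¹ * (∫ s in (0 : ℝ)..n * t, E₁.indicator (fun _ => (1 : ℝ)) s) - θ * t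
    = (n : ℝ)⁻¹ * p (n * t) by simp only [p]; field_simp, abs_mul, abs_of_pos (inv_pos.2 hn0)]
  calc (n : ℝ)⁻¹ * |p (n * t)| ≤ (n : ℝ)⁻¹ * C := by gcongr; exact hC' _
    _ ≤ ε := by
      rw [inv_mul_le_iff₀ hn0]
      exact ((div_lt_iff₀ hε).1 hn).le

/-! ### Density of test functions -/

theorem ae_norm_le_norm_Lp_top {α E : Type*} [MeasurableSpace α] {μ : Measure α}
    [NormedAddCommGroup E] (f : Lp E ∞ μ) : ∀ᵐ x ∂μ, ‖f x‖ ≤ ‖f‖ := by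
  rw [Lp.norm_def, toReal_eLpNorm (Lp.aestronglyMeasurable f)]
  exact ae_le_lpNorm_exponent_top (Lp.memLp f)

theorem norm_Lp_top_le_of_ae_bound {α E : Type*} [MeasurableSpace α] {μ : Measure α}
    [NormedAddCommGroup E] {f : Lp E ∞ μ} {C : ℝ} (hC : 0 ≤ C) (h : ∀ᵐ x ∂μ, ‖f x‖ ≤ C) :
    ‖f‖ ≤ C := by
  rw [Lp.norm_def, eLpNorm_exponent_top]
  exact ENNReal.toReal_le_of_le_ofReal hC (eLpNormEssSup_le_of_ae_bound h)

open scoped Manifold in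
/-- The indicator of a measurable set of finite measure is approximated in `L¹(Ω)` by test
functions. -/
theorem exists_test_function_near_indicator {Ω : Set (Eucl N)} (hΩ : IsOpen Ω)
    {s : Set (Eucl N)} (hs : MeasurableSet s) (hfin : leb Ω s < ⊤) {η : ℝ} (hη : 0 < η) :
    ∃ φ : Eucl N → ℝ, ContDiff ℝ (⊤ : ℕ∞) φ ∧ HasCompactSupport φ ∧ tsupport φ ⊆ Ω ∧
      ∫ x in Ω, ‖s.indicator (fun _ => (1 : ℝ)) x - φ x‖ ≤ η := by
  have hη' : ENNReal.ofReal (η / 2) ≠ 0 := by simpa using hη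
  rw [Measure.restrict_apply hs] at hfin
  obtain ⟨K, hKs, hK, hKc, hKm⟩ :=
    (hs.inter hΩ.measurableSet).exists_isCompact_isClosed_sdiff_lt hfin.ne hη'
  obtain ⟨V, hKV, hV, hVm⟩ := K.exists_isOpen_lt_add (μ := volume) hK.measure_lt_top.ne hη'
  obtain ⟨L, hL, hKL, hLV⟩ := exists_compact_between hK (hV.inter hΩ)
    (Set.subset_inter hKV (hKs.trans Set.inter_subset_right))
  obtain ⟨φ, hφ1, hφ0, hφ01⟩ :=
    exists_contMDiffMap_one_nhds_of_subset_interior (n := ⊤) 𝓘(ℝ, Eucl N) hKc hKL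
  have hφL : tsupport φ ⊆ L := closure_minimal
    (fun x hx => by_contra fun h => hx (hφ0 x h)) hL.isClosed
  have hφK : ∀ x ∈ K, φ x = 1 := fun x hx => hφ1.self_of_nhdsSet x hx
  refine ⟨φ, φ.contMDiff.contDiff, hL.of_isClosed_subset (isClosed_tsupport _) hφL,
    hφL.trans (hLV.trans Set.inter_subset_right), ?_⟩
  set T : Set (Eucl N) := ((s ∩ Ω) \ K) ∪ (V \ K)
  have hT : MeasurableSet T := ((hs.inter hΩ.measurableSet).diff hKc.measurableSet).union
    (hV.measurableSet.diff hKc.measurableSet)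
  have hVK : volume (V \ K) ≤ ENNReal.ofReal (η / 2) := by
    rw [measure_sdiff hKV hKc.measurableSet.nullMeasurableSet hK.measure_lt_top.ne]
    exact tsub_le_iff_left.2 hVm.le
  have hTm : volume T ≤ ENNReal.ofReal η := by
    refine (measure_union_le _ _).trans ((add_le_add hKm.le hVK).trans_eq ?_)
    rw [← ENNReal.ofReal_add (by positivity) (by positivity), add_halves]
  have hTfin : volume T ≠ ⊤ := (hTm.trans_lt ENNReal.ofReal_lt_top).ne
  -- the two functions differ only on `T`, and there by at most one
  have hb : ∀ᵐ x ∂(leb Ω), ‖s.indicator (fun _ => (1 : ℝ)) x - φ x‖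
      ≤ T.indicator (fun _ => (1 : ℝ)) x := by
    filter_upwards [ae_restrict_mem hΩ.measurableSet] with x hx
    have h01 := hφ01 x
    by_cases hxT : x ∈ T
    · rw [Set.indicator_of_mem hxT, Real.norm_eq_abs, abs_le]
      by_cases hxs : x ∈ s <;> simp [hxs] <;> constructor <;> linarith [h01.1, h01.2]
    · rw [Set.indicator_of_notMem hxT]
      by_cases hxK : x ∈ K
      · rw [hφK x hxK, Set.indicator_of_mem (hKs hxK).1]
        simp
      · have hxs : x ∉ s := fun h => hxT (Or.inl ⟨⟨h, hx⟩, hxK⟩)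
        have hxV : x ∉ V := fun h => hxT (Or.inr ⟨h, hxK⟩)
        rw [hφ0 x fun h => hxV (hLV h).1, Set.indicator_of_notMem hxs]
        simp
  have hTint : Integrable (T.indicator fun _ => (1 : ℝ)) volume :=
    (integrable_indicator_iff hT).2 (integrableOn_const hTfin)
  calc ∫ x in Ω, ‖s.indicator (fun _ => (1 : ℝ)) x - φ x‖
      ≤ ∫ x in Ω, T.indicator (fun _ => (1 : ℝ)) x :=
        integral_mono_of_nonneg (Eventually.of_forall fun _ => norm_nonneg _)
          hTint.restrict hb
    _ ≤ ∫ x, T.indicator (fun _ => (1 : ℝ)) x :=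
        setIntegral_le_integral hTint (Eventually.of_forall fun x =>
          Set.indicator_nonneg (fun _ _ => zero_le_one) x)
    _ = volume.real T := by rw [integral_indicator_const _ hT]; simp
    _ ≤ η := ENNReal.toReal_le_of_le_ofReal hη.le hTm

/-- A family of continuous linear functionals bounded in norm converges to zero pointwise on a
closed set. -/
theorem isClosed_setOf_tendsto_zero {X : Type*} [NormedAddCommGroup X] [NormedSpace ℝ X]
    {T : ℕ → X →L[ℝ] ℝ} {C : ℝ} (hC : ∀ n, ‖T n‖ ≤ C) :
    IsClosed {k | Tendsto (fun n => T n k) atTop (𝓝 0)} := by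
  have hC0 : 0 ≤ C := (norm_nonneg _).trans (hC 0)
  have he : Equicontinuous fun n => (T n : X → ℝ) := by
    refine (LipschitzWith.uniformEquicontinuous _ C.toNNReal fun n => ?_).equicontinuous
    refine (T n).lipschitz.weaken ?_
    rw [← NNReal.coe_le_coe, Real.coe_toNNReal _ hC0]
    exact hC n
  exact he.isClosed_setOfPred_tendsto continuous_const

/-! ### Weak* convergence -/

/-- If `z n → 0` in `L^∞(Ω)` with bounded gradients, then the gradients converge weakly* to zero. -/
theorem tendsto_weak_grad_zero {Ω : Set (Eucl N)} (hΩ : IsOpen Ω) {z : ℕ → W1inf Ω} {C : ℝ}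
    (hz : Tendsto (fun n => (z n).1.1) atTop (𝓝 0)) (hC : ∀ n, ‖(z n).1.2‖ ≤ C)
    (k : Lp (Eucl N) 1 (leb Ω)) :
    Tendsto (fun n => (innerSL ℝ (E := Eucl N)).lpPairing (leb Ω) ∞ 1 (z n).1.2 k) atTop
      (𝓝 0) := by
  set P := (innerSL ℝ (E := Eucl N)).lpPairing (leb Ω) ∞ 1
  have hPC : ∀ n, ‖P (z n).1.2‖ ≤ ‖P‖ * C := fun n =>
    (P.le_opNorm _).trans (mul_le_mul_of_nonneg_left (hC n) (norm_nonneg _))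
  have hC0 : 0 ≤ C := (norm_nonneg _).trans (hC 0)
  refine Lp.induction (by simp) (fun k => Tendsto (fun n => P (z n).1.2 k) atTop (𝓝 0))
    ?_ ?_ (isClosed_setOf_tendsto_zero hPC) k
  -- indicators are handled by approximation with test functions
  · intro c s hs hfin
    have hval : ∀ n, P (z n).1.2 (Lp.simpleFunc.indicatorConst 1 hs hfin.ne c)
        = ∫ x in Ω, s.indicator (fun _ => (1 : ℝ)) x * inner ℝ ((z n).1.2 x) c := by
      intro n
      rw [ContinuousLinearMap.lpPairing_eq_integral]
      refine integral_congr_ae ?_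
      rw [Lp.simpleFunc.coe_indicatorConst]
      filter_upwards [indicatorConstLp_coeFn (p := 1) (hs := hs) (hμs := hfin.ne) (c := c)]
        with x hx
      rw [hx]
      by_cases hxs : x ∈ s
      · simp only [Set.indicator_of_mem hxs, one_mul]
        rfl
      · simp [hxs]
    simp only [hval]
    rw [Metric.tendsto_atTop]
    intro ε hε
    have hD : 0 < C * ‖c‖ + 1 := by positivity
    obtain ⟨φ, hφ, hφc, hφs, hφη⟩ := exists_test_function_near_indicator hΩ hs hfin
      (η := ε / (2 * (C * ‖c‖ + 1))) (by positivity)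
    -- for a test function, integrate by parts and use the uniform convergence
    obtain ⟨c1, c2⟩ := test_fderiv hφ hφc c
    have hI : Integrable (fun x => fderiv ℝ φ x c) (leb Ω) :=
      c1.integrable_of_hasCompactSupport c2
    have hlim : Tendsto (fun n => ∫ x in Ω, φ x * inner ℝ ((z n).1.2 x) c) atTop (𝓝 0) := by
      have hb : ∀ n, ‖∫ x in Ω, φ x * inner ℝ ((z n).1.2 x) c‖
          ≤ ‖(z n).1.1‖ * ∫ x in Ω, ‖fderiv ℝ φ x c‖ := by
        intro n
        rw [← norm_neg, ← (z n).2 φ hφ hφc hφs c, ← integral_const_mul]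
        refine norm_integral_le_of_norm_le (hI.norm.const_mul _) ?_
        filter_upwards [ae_norm_le_norm_Lp_top (z n).1.1] with x hx
        rw [norm_mul]
        gcongr
      refine squeeze_zero_norm hb ?_
      have := (tendsto_zero_iff_norm_tendsto_zero.1 hz).mul_const (∫ x in Ω, ‖fderiv ℝ φ x c‖)
      simpa using this
    obtain ⟨n₀, hn₀⟩ := Metric.tendsto_atTop.1 hlim (ε / 2) (half_pos hε)
    refine ⟨n₀, fun n hn => ?_⟩
    have h2 := hn₀ n hn
    rw [dist_zero_right] at h2 ⊢
    have hφI : Integrable φ (leb Ω) := hφ.continuous.integrable_of_hasCompactSupport hφc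
    have hsI : Integrable (s.indicator fun _ => (1 : ℝ)) (leb Ω) :=
      (integrable_indicator_iff hs).2 (integrableOn_const hfin.ne)
    have hG := memLp_inner_const (Lp.memLp (z n).1.2) c
    have hdiff : (∫ x in Ω, s.indicator (fun _ => (1 : ℝ)) x * inner ℝ ((z n).1.2 x) c)
        - ∫ x in Ω, φ x * inner ℝ ((z n).1.2 x) c
        = ∫ x in Ω, (s.indicator (fun _ => (1 : ℝ)) x - φ x) * inner ℝ ((z n).1.2 x) c := by
      have hs' := hsI.mul_of_top_left hG
      have hφ' := hφI.mul_of_top_left hG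
      simp only [Pi.mul_def] at hs' hφ'
      rw [← integral_sub hs' hφ']
      simp only [sub_mul]
    have h1 : ‖∫ x in Ω, (s.indicator (fun _ => (1 : ℝ)) x - φ x) * inner ℝ ((z n).1.2 x) c‖
        < ε / 2 := by
      calc _ ≤ ∫ x in Ω, ‖s.indicator (fun _ => (1 : ℝ)) x - φ x‖ * (C * ‖c‖) := by
            refine norm_integral_le_of_norm_le ((hsI.sub hφI).norm.mul_const _) ?_
            filter_upwards [ae_norm_le_norm_Lp_top (z n).1.2] with x hx
            rw [norm_mul]
            gcongr
            refine (norm_inner_le_norm _ _).trans ?_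
            gcongr
            exact hx.trans (hC n)
        _ ≤ ε / (2 * (C * ‖c‖ + 1)) * (C * ‖c‖) := by
            rw [integral_mul_const]
            gcongr
        _ < ε / (2 * (C * ‖c‖ + 1)) * (C * ‖c‖ + 1) := by
            gcongr
            linarith
        _ = ε / 2 := by field_simp
    rw [← hdiff] at h1
    have := norm_le_insert' (∫ x in Ω, s.indicator (fun _ => (1 : ℝ)) x * inner ℝ ((z n).1.2 x) c)
      (∫ x in Ω, φ x * inner ℝ ((z n).1.2 x) c)
    linarith
  · intro f g hf hg _ h1 h2
    simpa only [map_add, add_zero] using h1.add h2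

theorem W1inf.tendsto_weakStar {Ω : Set (Eucl N)} (hΩ : IsOpen Ω) {u : ℕ → W1inf Ω} {u₀ : W1inf Ω}
    {C : ℝ} (hu : Tendsto (fun n => (u n).1.1) atTop (𝓝 u₀.1.1))
    (hC : ∀ n, ‖(u n).1.2‖ ≤ C) :
    Tendsto u atTop (@nhds _ (weakStar Ω) u₀) := by
  rw [nhds_induced, tendsto_comap_iff]
  have hz : Tendsto (fun n => (u n - u₀).1.1) atTop (𝓝 0) := by
    simpa using hu.sub_const u₀.1.1
  refine Tendsto.prodMk_nhds ?_ ?_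
  · refine tendsto_iff_forall_eval_tendsto_topDualPairing.2 fun k => ?_
    exact ((((ContinuousLinearMap.mul ℝ ℝ).lpPairing (leb Ω) ∞ 1).flip k).continuous.tendsto
      _).comp hu
  · refine tendsto_iff_forall_eval_tendsto_topDualPairing.2 fun k => ?_
    have := tendsto_weak_grad_zero hΩ (z := fun n => u n - u₀) (C := C + ‖u₀.1.2‖) hz
      (fun n => (norm_sub_le _ _).trans (by gcongr; exact hC n)) k
    simp only [Submodule.coe_sub, Prod.snd_sub, map_sub, _root_.sub_apply] at this
    exact tendsto_sub_nhds_zero_iff.1 this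

/-- In each of the topologies `τ_∞`, `w*` and `w*_seq`, closed sets are closed under limits in
`L^∞(Ω)` of sequences with bounded gradients. -/
theorem mem_of_isClosed_of_tendsto {Ω : Set (Eucl N)} (hΩ : IsOpen Ω)
    {τ : TopologicalSpace (W1inf Ω)}
    (hτ : τ = tauInf Ω ∨ τ = weakStar Ω ∨ τ = seqTopology (weakStar Ω))
    {S : Set (W1inf Ω)} (hS : IsClosed[τ] S) {u : ℕ → W1inf Ω} {u₀ : W1inf Ω} {C : ℝ}
    (hu : Tendsto (fun n => (u n).1.1) atTop (𝓝 u₀.1.1)) (hC : ∀ n, ‖(u n).1.2‖ ≤ C)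
    (hmem : ∀ n, u n ∈ S) : u₀ ∈ S := by
  have hw := W1inf.tendsto_weakStar hΩ hu hC
  rcases hτ with rfl | rfl | rfl
  · let _ := tauInf Ω
    refine hS.mem_of_tendsto (f := u) (b := atTop) ?_ (Eventually.of_forall hmem)
    rw [nhds_induced, tendsto_comap_iff]
    exact hu
  · let _ := weakStar Ω
    exact hS.mem_of_tendsto hw (Eventually.of_forall hmem)
  · rw [isClosed_seqTopology_iff] at hS
    let _ := weakStar Ω
    exact hS hmem hw

/-! ### Sublevel sets of the supremal functional -/

theorem supremal_le_iff {f : Eucl N → Eucl N → EReal} {Ω : Set (Eucl N)} {u : W1inf Ω}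
    {A : Set (Eucl N)} {c : EReal} :
    supremal f u A ≤ c ↔ ∀ᵐ x ∂(leb A), f x (grad u x) ≤ c :=
  ⟨fun h => (ae_le_essSup).mono fun _ hx => hx.trans h, fun h => essSup_le_of_ae_le c h⟩

/-- A property that holds almost everywhere on each ball contained in the open set `A` holds
almost everywhere on `A`. -/
theorem ae_restrict_of_ball {A : Set (Eucl N)} (hA : IsOpen A) {p : Eucl N → Prop}
    (h : ∀ x r, 0 < r → Metric.ball x r ⊆ A → ∀ᵐ y ∂(leb (Metric.ball x r)), p y) :
    ∀ᵐ y ∂(leb A), p y := by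
  rw [ae_iff, Measure.restrict_apply₀' hA.measurableSet.nullMeasurableSet]
  refine measure_null_of_locally_null _ fun x hx => ?_
  obtain ⟨r, hr, hrA⟩ := Metric.isOpen_iff.1 hA x hx.2
  refine ⟨{y | ¬ p y} ∩ Metric.ball x r, ?_, ?_⟩
  · exact inter_mem (mem_of_superset self_mem_nhdsWithin Set.inter_subset_left)
      (mem_nhdsWithin_of_mem_nhds (Metric.ball_mem_nhds x hr))
  · have := h x r hr hrA
    rwa [ae_iff, Measure.restrict_apply₀' Metric.isOpen_ball.measurableSet.nullMeasurableSet]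
      at this

/-- If `F(·, B)` is lower semicontinuous, its sublevel sets are convex. With `w = u₁ - u₂`, the
functions `u₂ + z n`, where `z n` is `w` composed with a function of slopes `0` and `1` close to
`t ↦ θ t`, have gradients in `{Du₁, Du₂}` and converge uniformly to `θ u₁ + (1 - θ) u₂`. -/
theorem supremal_ball_le {Ω : Set (Eucl N)} (hΩ : IsOpen Ω) {f : Eucl N → Eucl N → EReal}
    {τ : TopologicalSpace (W1inf Ω)}
    (hτ : τ = tauInf Ω ∨ τ = weakStar Ω ∨ τ = seqTopology (weakStar Ω))
    {B : Set (Eucl N)} (hB : B ⊆ Ω) (hlsc : IsLSC τ fun u : W1inf Ω => supremal f u B)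
    {θ : ℝ} (h0 : 0 < θ) (h1 : θ < 1) {u₁ u₂ : W1inf Ω} {c : ℝ}
    (hu₁ : supremal f u₁ B ≤ c) (hu₂ : supremal f u₂ B ≤ c) :
    supremal f (θ • u₁ + (1 - θ) • u₂) B ≤ c := by
  have hn : ∀ n : ℕ, (0 : ℝ) < 1 / ((n : ℝ) + 1) := fun n => by positivity
  choose E hE hEn using fun n => exists_isClosed_integral_indicator_near h0 h1 (hn n)
  obtain ⟨w, hw⟩ : ∃ w, w = u₁ - u₂ := ⟨_, rfl⟩
  choose z hz hzg using fun n => W1inf.exists_comp_integral_indicator hΩ w (hE n)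
  refine mem_of_isClosed_of_tendsto hΩ hτ (hlsc c) (u := fun n => u₂ + z n)
    (C := ‖u₂.1.2‖ + ‖w.1.2‖) ?_ (fun n => ?_) fun n => ?_
  · have hlim : Tendsto (fun n => (z n).1.1) atTop (𝓝 (θ • w.1.1)) := by
      rw [tendsto_iff_norm_sub_tendsto_zero]
      refine squeeze_zero (fun _ => norm_nonneg _) (fun n => ?_)
        (tendsto_one_div_add_atTop_nhds_zero_nat (𝕜 := ℝ))
      refine norm_Lp_top_le_of_ae_bound (hn n).le ?_
      filter_upwards [hz n, Lp.coeFn_sub (z n).1.1 (θ • w.1.1), Lp.coeFn_smul θ w.1.1]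
        with x hx hx1 hx2
      rw [hx1, Pi.sub_apply, hx2, hx]
      exact hEn n _
    have hval : (θ • u₁ + (1 - θ) • u₂).1.1 = u₂.1.1 + θ • w.1.1 := by
      rw [hw]
      change θ • u₁.1.1 + (1 - θ) • u₂.1.1 = u₂.1.1 + θ • (u₁.1.1 - u₂.1.1)
      module
    rw [hval]
    exact hlim.const_add u₂.1.1
  · refine (norm_add_le _ _).trans (add_le_add_right ?_ _)
    refine Lp.norm_le_norm_of_ae_le ?_
    filter_upwards [hzg n] with x hx
    change ‖grad (z n) x‖ ≤ ‖grad w x‖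
    rw [hx, norm_smul]
    refine mul_le_of_le_one_left (norm_nonneg _) ?_
    by_cases h : w.1.1 x ∈ E n <;> simp [h]
  -- where `w x ∈ E n` the gradient is `Du₁`, elsewhere it is `Du₂`
  · have hle : leb B ≤ leb Ω := Measure.restrict_mono_set _ hB
    rw [Set.mem_ofPred_eq, supremal_le_iff] at *
    filter_upwards [hu₁, hu₂, (Measure.absolutelyContinuous_of_le hle).ae_le (hzg n),
      (Measure.absolutelyContinuous_of_le hle).ae_le (Lp.coeFn_sub u₁.1.2 u₂.1.2),
      (Measure.absolutelyContinuous_of_le hle).ae_le (Lp.coeFn_add u₂.1.2 (z n).1.2)]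
      with x h1 h2 h3 h4 h5
    have h5' : grad (u₂ + z n) x = grad u₂ x + grad (z n) x := h5
    have h4' : grad w x = grad u₁ x - grad u₂ x := by rw [hw]; exact h4
    rw [h5', h3, h4']
    by_cases h : w.1.1 x ∈ E n
    · simpa [h] using h1
    · simpa [h] using h2

end Supremal

theorem mainTheorem5 {N : ℕ} (Ω : Set (Supremal.Eucl N)) (hΩ : IsOpen Ω)
    (hb : Bornology.IsBounded Ω)
    (f : Supremal.Eucl N → Supremal.Eucl N → EReal)
    (hf : Measurable (fun p : Ω × Supremal.Eucl N => f p.1 p.2))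
    (τ : TopologicalSpace (Supremal.W1inf Ω))
    (hτ : τ = Supremal.tauInf Ω ∨ τ = Supremal.weakStar Ω ∨
      τ = Supremal.seqTopology (Supremal.weakStar Ω))
    (hlsc : ∀ (x : Supremal.Eucl N) (r : ℝ), 0 < r → Metric.ball x r ⊆ Ω →
      Supremal.IsLSC τ (fun u : Supremal.W1inf Ω => Supremal.supremal f u (Metric.ball x r)))
    (hH : ∀ (x : Supremal.Eucl N) (r : ℝ), 0 < r → Metric.ball x r ⊆ Ω →
      Supremal.HypH (Metric.isOpen_ball (x := x) (ε := r)) Metric.isBounded_ball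
        (fun u : Supremal.W1inf (Metric.ball x r) =>
          Supremal.supremal f u (Metric.ball x r))) :
    ∀ A : Set (Supremal.Eucl N), IsOpen A → A ⊆ Ω →
      Supremal.LevelConvex (fun u : Supremal.W1inf Ω => Supremal.supremal f u A) := by
  intro A hA hAΩ θ h0 h1 u₁ u₂
  -- it suffices to treat the real levels above the maximum
  refine EReal.le_of_forall_lt_iff_le.1 fun c hc => ?_
  have hle : ∀ {u : Supremal.W1inf Ω} {B : Set (Supremal.Eucl N)}, B ⊆ A →
      Supremal.supremal f u A ≤ (c : EReal) → Supremal.supremal f u B ≤ (c : EReal) := by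
    intro u B hBA h
    rw [Supremal.supremal_le_iff] at h ⊢
    exact ae_mono (Measure.restrict_mono_set _ hBA) h
  refine Supremal.supremal_le_iff.2 (Supremal.ae_restrict_of_ball hA fun x r hr hxA =>
    Supremal.supremal_le_iff.1 ?_)
  exact Supremal.supremal_ball_le hΩ hτ (hxA.trans hAΩ) (hlsc x r hr (hxA.trans hAΩ)) h0 h1
    (hle hxA (le_sup_left.trans hc.le)) (hle hxA (le_sup_right.trans hc.le))
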